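/- Let $C_0=\ln\int_{\mathbb R}e^{-x^2/2-x^4/4}\,dx$, $U(x)=\frac{x^2}{2}+\frac{x^4}{4}+C_0$, and for Borel probability measures $\rho$ on $\mathbb R$ let $F(\rho)=\mathrm{KL}(\rho\,|\,e^{-U}dx)\in[0,+\infty]$. Let $\mathcal P_2(\mathbb R)$ be the set of probability measures with finite second moment, with the Wasserstein distance $W_2$. Let $D(|\partial F|)$ be the set of $\mu\in\mathcal P_2(\mathbb R)$ with $F(\mu)<\infty$ and finite metric slope $$|\partial F|(\mu)=\limsup_{\nu\to\mu}\frac{(F(\mu)-F(\nu))^+}{W_2(\mu,\nu)}<\infty$$ (limit in $(\mathcal P_2(\mathbb R),W_2)$, $\nu\ne\mu$). A first variation of $F$ at $\rho$ is a function $g$, integrable with respect to $\rho$ and to every test measure $\nu$ below, such that for every probability measure $\nu$ with bounded compactly supported density, $F(\rho+\varepsilon(\nu-\rho))<\infty$ for $\varepsilon\in[0,1]$ and $\frac{d}{d\varepsilon}F(\rho+\varepsilon(\nu-\rho))\big|_{\varepsilon=0^+}=\int g\,d\nu-\int g\,d\rho$. Write $\nabla\frac{\delta F}{\delta\rho}\big|_\rho$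 for the derivative of an everywhere differentiable first variation of $F$ at $\rho$. **Proposition.** Let $\rho_0$ have density $p_0(x)=\frac1{\sqrt{2\pi}}e^{-x^2/2}$. Then $F$ has a differentiable first variation at $\rho_0$. Let $v=\nabla\frac{\delta F}{\delta\rho}\big|_{\rho_0}$ be the derivative of any such first variation, let $h>0$, $T=\mathrm{Id}-hv$ (the forward-Euler map), $\rho_1=T_\sharp\rho_0$ (one forward-Euler step) and $c=\frac23\sqrt{\frac1{3h}}$. Then: 1. $T(x)=x-hx^3$ for all $x\in\mathbb R$, and $T$ is not injective. 2. $\rho_1\in\mathcal P_2(\mathbb R)$, and $\rho_1$ has a Lebesgue density $p_1:\mathbb R\to[0,\infty)$ such that $p_1(y)\to+\infty$ as $y\uparrow c$ and as $y\downarrow-c$, while $p_1$ has finite limits as $y\downarrow c$ and as $y\uparrow-c$. 3. Every function that is almost everywhere equal to $p_1$ is discontinuous at $c$ and at $-c$ and does not belong to $W^{1,1}_{\mathrm{loc}}(\mathbb R)$. 4. $\rho_1\notin D(|\partial F|)$. -/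

import Mathlib

open MeasureTheory ProbabilityTheory InformationTheory Filter Topology
open scoped ENNReal NNReal ContDiff

noncomputable section

/-- The space `𝒫₂(ℝ)` of Borel probability measures on `ℝ` with finite second moment. -/
def P2 : Set (Measure ℝ) :=
  {μ | IsProbabilityMeasure μ ∧ ∫⁻ x, ‖x‖ₑ ^ 2 ∂μ < ⊤}

/-- The couplings (transport plans) of two measures. -/
def couplings (μ ν : Measure ℝ) : Set (Measure (ℝ × ℝ)) :=
  {π | π.map Prod.fst = μ ∧ π.map Prod.snd = ν}

/-- The Wasserstein distance `W₂`. -/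
def W2 (μ ν : Measure ℝ) : ℝ≥0∞ :=
  (⨅ π ∈ couplings μ ν, ∫⁻ z, edist z.1 z.2 ^ 2 ∂π) ^ (1 / 2 : ℝ)

/-- The metric slope `|∂F|(μ) = limsup_{ν → μ} (F(μ) - F(ν))⁺ / W₂(μ, ν)` in `(𝒫₂(ℝ), W₂)`.
Subtraction in `[0, ∞]` is truncated, so it is the positive part. -/
def metricSlope (F : Measure ℝ → ℝ≥0∞) (μ : Measure ℝ) : ℝ≥0∞ :=
  ⨅ (r : ℝ≥0∞) (_ : 0 < r),
    ⨆ (ν : Measure ℝ) (_ : ν ∈ P2) (_ : ν ≠ μ) (_ : W2 μ ν < r), (F μ - F ν) / W2 μ ν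

/-- The domain `D(|∂F|)`: the measures in `𝒫₂(ℝ)` with finite energy and finite slope. -/
def slopeDomain (F : Measure ℝ → ℝ≥0∞) : Set (Measure ℝ) :=
  {μ | μ ∈ P2 ∧ F μ < ⊤ ∧ metricSlope F μ < ⊤}

/-- Probability measures with a bounded, compactly supported Lebesgue density: the measures
towards which a first variation is tested. -/
def IsBoundedCompactDensity (ν : Measure ℝ) : Prop :=
  IsProbabilityMeasure ν ∧ ∃ q : ℝ → ℝ≥0, Measurable q ∧ (∃ M, ∀ x, q x ≤ M) ∧
    HasCompactSupport q ∧ ν = volume.withDensity (fun x => (q x : ℝ≥0∞))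

/-- The convex combination `(1 - ε) ρ + ε ν = ρ + ε (ν - ρ)`, for `ε ∈ [0, 1]`. -/
def mix (ρ ν : Measure ℝ) (ε : ℝ) : Measure ℝ :=
  ENNReal.ofReal (1 - ε) • ρ + ENNReal.ofReal ε • ν

/-- `g` is a first variation `δF/δρ` of `F` at `ρ`: for every probability measure `ν` with
bounded, compactly supported density, `F` is finite on the segment from `ρ` to `ν` and
`d/dε F(ρ + ε (ν - ρ))` at `ε = 0⁺` equals `∫ g d(ν - ρ)`. -/
def IsFirstVariation (F : Measure ℝ → ℝ≥0∞) (ρ : Measure ℝ) (g : ℝ → ℝ) : Prop :=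
  Integrable g ρ ∧ ∀ ν : Measure ℝ, IsBoundedCompactDensity ν →
    Integrable g ν ∧ (∀ ε ∈ Set.Icc (0 : ℝ) 1, F (mix ρ ν ε) < ⊤) ∧
    HasDerivWithinAt (fun ε => (F (mix ρ ν ε)).toReal) (∫ x, g x ∂ν - ∫ x, g x ∂ρ)
      (Set.Icc 0 1) 0

/-- `v` is the `W₂` gradient `∇ (δF/δρ)` of `F` at `ρ`: the derivative of a differentiable
first variation. -/
def IsW2Gradient (F : Measure ℝ → ℝ≥0∞) (ρ : Measure ℝ) (v : ℝ → ℝ) : Prop :=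
  ∃ g : ℝ → ℝ, IsFirstVariation F ρ g ∧ ∀ x, HasDerivAt g (v x) x

/-- The forward-Euler map `Id - h v`. -/
def eulerMap (h : ℝ) (v : ℝ → ℝ) : ℝ → ℝ := fun x => x - h * v x

/-- `W^{1,1}_loc(ℝ)`: locally integrable, with a locally integrable weak derivative. -/
def MemW11loc (p : ℝ → ℝ) : Prop :=
  LocallyIntegrable p volume ∧ ∃ q : ℝ → ℝ, LocallyIntegrable q volume ∧
    ∀ φ : ℝ → ℝ, ContDiff ℝ ∞ φ → HasCompactSupport φ →
      ∫ x, p x * deriv φ x = - ∫ x, q x * φ x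

/-- The potential `U(x) = x²/2 + x⁴/4 + C₀`, where `C₀` normalizes `e^{-U}`. -/
def potentialU (x : ℝ) : ℝ :=
  x ^ 2 / 2 + x ^ 4 / 4 + Real.log (∫ t : ℝ, Real.exp (-(t ^ 2 / 2) - t ^ 4 / 4))

/-- The target probability measure with density `e^{-U}`. -/
def targetMeasure : Measure ℝ :=
  volume.withDensity (fun x => ENNReal.ofReal (Real.exp (-potentialU x)))

/-- The energy `F(ρ) = KL(ρ | e^{-U})`. -/
def energyF (ρ : Measure ℝ) : ℝ≥0∞ := klDiv ρ targetMeasure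

end

/-! Relative to `targetMeasure`, the Gaussian has log-density `x⁴/4` plus a constant, because the
quadratic terms cancel. The first variation is therefore `x⁴/4`, unique up to a constant among
continuous ones (`IsFirstVariation.exists_eq_add_const`), so `v = x³` and `T = x - h x³`.

With `a = √(1/(3h))`, the map `T` folds the line at `±a`, with critical values `±c = ±2a/3`. The
density of `ρ₁` is a sum over the three monotone branches of Gaussian density over `|T'|`
(`exists_density_map_cubic`). Just below `c` the fold makes it infinite; just above `c` only the
branch through the regular point `-2a` remains. The picture at `-c` is symmetric.

One family of test functions, stepping steeply just left of `c`, excludes both Sobolev regularity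
and finite slope: `∫ p φ'` is unbounded over `|φ| ≤ 1` supported in `[c - 2, c]`
(`exists_test_lt_integral_mul_deriv`). A locally integrable weak derivative would bound it. So would
a finite slope: transport by `Id + tφ` costs at most `t` in `W₂` and lowers the energy by at least
`t ∫ φ' dρ - O(t)`, with a constant independent of `φ'`
(`exists_integral_deriv_le_of_mem_slopeDomain`). -/

/-! ### Differentiating relative entropy along a segment of densities. -/

section KLMixture

lemma klFun_tangent_le {x y : ℝ} (hx : 0 < x) (hy : 0 ≤ y) :
    klFun x + Real.log x * (y - x) ≤ klFun y := by
  -- `x * klFun (y / x)` is exactly the Bregman gap between `klFun y` and its tangent at `x`.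
  have h := mul_nonneg hx.le (klFun_nonneg (div_nonneg hy hx.le))
  rcases hy.eq_or_lt with rfl | hy
  · simp only [klFun_apply]; simp; nlinarith
  · rw [klFun_apply, Real.log_div hy.ne' hx.ne'] at h
    have : x * (y / x * (Real.log y - Real.log x) + 1 - y / x)
        = y * (Real.log y - Real.log x) + x - y := by field_simp
    rw [this] at h
    simp only [klFun_apply]; nlinarith

variable {α : Type*} [MeasurableSpace α] {π : Measure α}

lemma klDiv_withDensity_ofReal [IsFiniteMeasure π] {f : α → ℝ} (hf : Measurable f)
    (hf0 : ∀ x, 0 ≤ f x) (hfin : Integrable f π) :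
    klDiv (π.withDensity fun x => ENNReal.ofReal (f x)) π
      = ∫⁻ x, ENNReal.ofReal (klFun (f x)) ∂π := by
  have : IsFiniteMeasure (π.withDensity fun x => ENNReal.ofReal (f x)) :=
    isFiniteMeasure_withDensity_ofReal hfin.2
  rw [klDiv_eq_lintegral_klFun_of_ac (withDensity_absolutelyContinuous _ _)]
  refine lintegral_congr_ae ?_
  filter_upwards [Measure.rnDeriv_withDensity π hf.ennreal_ofReal] with x hx
  rw [hx, ENNReal.toReal_ofReal (hf0 x)]

lemma integral_withDensity_ofReal {f : α → ℝ} (hf : Measurable f) (hf0 : ∀ x, 0 ≤ f x)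
    (g : α → ℝ) :
    ∫ x, g x ∂(π.withDensity fun x => ENNReal.ofReal (f x)) = ∫ x, f x * g x ∂π := by
  rw [integral_withDensity_eq_integral_toReal_smul hf.ennreal_ofReal (by simp)]
  simp [ENNReal.toReal_ofReal, hf0]

lemma integrable_withDensity_ofReal_iff {f : α → ℝ} (hf : Measurable f) (hf0 : ∀ x, 0 ≤ f x)
    (g : α → ℝ) :
    Integrable g (π.withDensity fun x => ENNReal.ofReal (f x)) ↔
      Integrable (fun x => f x * g x) π := by
  rw [integrable_withDensity_iff_integrable_smul₀' hf.ennreal_ofReal.aemeasurable (by simp)]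
  simp [ENNReal.toReal_ofReal, hf0]

lemma integrable_klFun_mix [IsFiniteMeasure π] {f k : α → ℝ} (hf : Measurable f) (hk : Measurable k)
    (hf0 : ∀ x, 0 ≤ f x) (hk0 : ∀ x, 0 ≤ k x)
    (hif : Integrable (fun x => klFun (f x)) π) (hik : Integrable (fun x => klFun (k x)) π)
    {ε : ℝ} (hε : ε ∈ Set.Icc (0 : ℝ) 1) :
    Integrable (fun x => klFun ((1 - ε) * f x + ε * k x)) π := by
  refine ((hif.const_mul (1 - ε)).add (hik.const_mul ε)).mono'
    (measurable_klFun.comp (by fun_prop)).aestronglyMeasurable (ae_of_all _ fun x => ?_)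
  have h1 : 0 ≤ 1 - ε := by linarith [hε.2]
  rw [Real.norm_of_nonneg (klFun_nonneg (add_nonneg (mul_nonneg h1 (hf0 x))
    (mul_nonneg hε.1 (hk0 x))))]
  exact convexOn_klFun.2 (hf0 x) (hk0 x) h1 hε.1 (by ring)

/-- One-sided derivative of an integrated `klFun` along a segment of densities. -/
lemma hasDerivWithinAt_integral_klFun_mix [IsFiniteMeasure π] {f k : α → ℝ} (hf : Measurable f)
    (hk : Measurable k) (hf0 : ∀ x, 0 < f x) (hk0 : ∀ x, 0 ≤ k x)
    (hif : Integrable (fun x => klFun (f x)) π) (hik : Integrable (fun x => klFun (k x)) π)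
    (hl : Integrable (fun x => Real.log (f x) * (k x - f x)) π) :
    HasDerivWithinAt (fun ε : ℝ => ∫ x, klFun ((1 - ε) * f x + ε * k x) ∂π)
      (∫ x, Real.log (f x) * (k x - f x) ∂π) (Set.Icc 0 1) 0 := by
  have hI : Set.Icc (0 : ℝ) 1 \ {0} = Set.Ioc 0 1 := by
    ext x; simp [lt_iff_le_and_ne, eq_comm]
  rw [hasDerivWithinAt_iff_tendsto_slope, hI]
  have key : Tendsto (fun ε : ℝ => ∫ x, ε⁻¹ * (klFun ((1 - ε) * f x + ε * k x) - klFun (f x)) ∂π)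
      (𝓝[Set.Ioc 0 1] 0) (𝓝 (∫ x, Real.log (f x) * (k x - f x) ∂π)) := by
    refine tendsto_integral_filter_of_dominated_convergence
      (fun x => |Real.log (f x) * (k x - f x)| + (|klFun (k x)| + |klFun (f x)|)) ?_ ?_ ?_ ?_
    · refine Eventually.of_forall fun ε => Measurable.aestronglyMeasurable ?_
      exact (((measurable_klFun.comp (by fun_prop)).sub (measurable_klFun.comp hf))).const_mul _
    · filter_upwards [self_mem_nhdsWithin] with ε hε
      refine ae_of_all _ fun x => ?_
      -- Convexity traps the difference quotient between the tangent slope and the chord slope,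
      -- which are integrable and do not depend on `ε`.
      have h1 : 0 ≤ 1 - ε := by linarith [hε.2]
      have hlow := klFun_tangent_le (hf0 x) (add_nonneg (mul_nonneg h1 (hf0 x).le)
        (mul_nonneg hε.1.le (hk0 x)))
      have hup := convexOn_klFun.2 (hf0 x).le (hk0 x) h1 hε.1.le (by ring)
      simp only [smul_eq_mul] at hup
      have e1 : ε⁻¹ * (klFun ((1 - ε) * f x + ε * k x) - klFun (f x)) ≤ klFun (k x) - klFun (f x) := by
        rw [inv_mul_le_iff₀ hε.1]; nlinarith
      have e2 : Real.log (f x) * (k x - f x)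
          ≤ ε⁻¹ * (klFun ((1 - ε) * f x + ε * k x) - klFun (f x)) := by
        rw [le_inv_mul_iff₀ hε.1]; nlinarith
      rw [Real.norm_eq_abs, abs_le]
      constructor
      · linarith [neg_abs_le (Real.log (f x) * (k x - f x)), abs_nonneg (klFun (k x)),
          abs_nonneg (klFun (f x))]
      · linarith [le_abs_self (klFun (k x)), neg_abs_le (klFun (f x)),
          abs_nonneg (Real.log (f x) * (k x - f x))]
    · exact hl.abs.add (hik.abs.add hif.abs)
    · refine ae_of_all _ fun x => ?_
      have h1 : HasDerivAt (fun ε : ℝ => (1 - ε) * f x + ε * k x) (k x - f x) 0 := by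
        have := (((hasDerivAt_id (0 : ℝ)).const_sub 1).mul_const (f x)).add
          ((hasDerivAt_id (0 : ℝ)).mul_const (k x))
        refine this.congr_deriv ?_
        ring
      have h2 : HasDerivAt klFun (Real.log (f x)) ((1 - 0) * f x + 0 * k x) := by
        have := hasDerivAt_klFun (hf0 x).ne'
        simpa using this
      have h3 := (h2.comp (0 : ℝ) h1).hasDerivWithinAt (s := Set.Icc 0 1)
      rw [hasDerivWithinAt_iff_tendsto_slope, hI] at h3
      refine h3.congr fun ε => ?_
      simp [slope_def_field, div_eq_inv_mul]
  refine key.congr' ?_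
  filter_upwards [self_mem_nhdsWithin] with ε hε
  rw [integral_const_mul, integral_sub (integrable_klFun_mix hf hk (fun x => (hf0 x).le) hk0 hif hik
    ⟨hε.1.le, hε.2⟩) hif]
  simp [slope_def_field, div_eq_inv_mul]

end KLMixture

/-! ### The first variation at the Gaussian and its uniqueness. -/

section Target

lemma integrable_exp_neg_quartic :
    Integrable fun t : ℝ => Real.exp (-(t ^ 2 / 2) - t ^ 4 / 4) := by
  refine (integrable_exp_neg_mul_sq (b := 1 / 2) (by norm_num)).mono'
    (by fun_prop) (ae_of_all _ fun t => ?_)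
  rw [Real.norm_of_nonneg (Real.exp_pos _).le]
  refine Real.exp_le_exp.2 ?_
  nlinarith [sq_nonneg (t ^ 2)]

lemma exp_neg_potentialU (x : ℝ) :
    Real.exp (-potentialU x) = Real.exp (-(x ^ 2 / 2) - x ^ 4 / 4) /
      ∫ t : ℝ, Real.exp (-(t ^ 2 / 2) - t ^ 4 / 4) := by
  have hZ := integral_exp_pos integrable_exp_neg_quartic
  rw [potentialU, eq_div_iff hZ.ne']
  nth_rewrite 2 [← Real.exp_log hZ]
  rw [← Real.exp_add]
  ring_nf

lemma continuous_potentialU : Continuous potentialU := by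
  unfold potentialU; fun_prop

instance isProbabilityMeasure_targetMeasure : IsProbabilityMeasure targetMeasure := by
  constructor
  have hZ := integral_exp_pos integrable_exp_neg_quartic
  have hi : Integrable fun x => Real.exp (-potentialU x) := by
    simp_rw [exp_neg_potentialU]
    exact integrable_exp_neg_quartic.div_const _
  rw [targetMeasure, withDensity_apply _ MeasurableSet.univ, setLIntegral_univ,
    ← ofReal_integral_eq_lintegral_ofReal hi (ae_of_all _ fun x => (Real.exp_pos _).le)]
  simp_rw [exp_neg_potentialU]
  rw [integral_div, div_self hZ.ne', ENNReal.ofReal_one]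

lemma withDensity_eq_targetMeasure_withDensity {f : ℝ → ℝ} (hf : Measurable f) :
    (volume.withDensity fun x => ENNReal.ofReal (f x)) =
      targetMeasure.withDensity fun x => ENNReal.ofReal (f x * Real.exp (potentialU x)) := by
  have hU := continuous_potentialU
  rw [targetMeasure, ← withDensity_mul _ (by fun_prop) (by fun_prop)]
  congr 1
  ext x
  rw [Pi.mul_apply, ← ENNReal.ofReal_mul (Real.exp_pos _).le, Real.exp_neg]
  congr 1
  field_simp

lemma gaussianReal_eq_targetMeasure_withDensity :
    gaussianReal 0 1 = targetMeasure.withDensity fun x =>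
      ENNReal.ofReal (gaussianPDFReal 0 1 x * Real.exp (potentialU x)) := by
  rw [gaussianReal_of_var_ne_zero 0 one_ne_zero, gaussianPDF_def]
  exact withDensity_eq_targetMeasure_withDensity (measurable_gaussianPDFReal 0 1)

/-- The `x²/2` in the Gaussian exponent cancels the one in `potentialU`; the quartic left over is
what makes the Euler map cubic. -/
lemma exists_log_gaussianPDFReal_mul_exp : ∃ κ : ℝ, ∀ x,
    Real.log (gaussianPDFReal 0 1 x * Real.exp (potentialU x)) = x ^ 4 / 4 + κ := by
  refine ⟨Real.log (√(2 * Real.pi))⁻¹ +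
    Real.log (∫ t : ℝ, Real.exp (-(t ^ 2 / 2) - t ^ 4 / 4)), fun x => ?_⟩
  have h : 0 < (√(2 * Real.pi))⁻¹ := by positivity
  simp only [gaussianPDFReal, NNReal.coe_one, mul_one]
  rw [Real.log_mul (by positivity) (Real.exp_pos _).ne', Real.log_mul h.ne' (Real.exp_pos _).ne',
    Real.log_exp, Real.log_exp, potentialU]
  ring

lemma integrable_pow_gaussianReal (n : ℕ) : Integrable (fun x : ℝ => x ^ n) (gaussianReal 0 1) := by
  rcases Nat.eq_zero_or_pos n with rfl | hn
  · simp
  have := (memLp_id_gaussianReal' (μ := 0) (v := 1) (n : ℝ≥0∞) (by simp)).integrable_norm_pow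
    hn.ne'
  refine this.mono' (by fun_prop) (ae_of_all _ fun x => ?_)
  simp

/-- The quartic `x⁴ / 4` is a first variation of the energy at the standard Gaussian. -/
lemma isFirstVariation_quartic :
    IsFirstVariation energyF (gaussianReal 0 1) fun x => x ^ 4 / 4 := by
  have hU := continuous_potentialU
  have hgi : Integrable (fun x : ℝ => x ^ 4 / 4) (gaussianReal 0 1) :=
    (integrable_pow_gaussianReal 4).div_const 4
  refine ⟨hgi, ?_⟩
  rintro ν ⟨hν, q, hq, ⟨M, hM⟩, hqc, rfl⟩
  obtain ⟨κ, hκ⟩ := exists_log_gaussianPDFReal_mul_exp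
  set ν := volume.withDensity fun x => (q x : ℝ≥0∞) with hνdef
  set f : ℝ → ℝ := fun x => gaussianPDFReal 0 1 x * Real.exp (potentialU x) with hfdef
  set k : ℝ → ℝ := fun x => (q x : ℝ) * Real.exp (potentialU x) with hkdef
  have hfm : Measurable f := (measurable_gaussianPDFReal 0 1).mul (by fun_prop)
  have hkm : Measurable k := hq.coe_nnreal_real.mul (by fun_prop)
  have hf0 : ∀ x, 0 < f x := fun x =>
    mul_pos (gaussianPDFReal_pos _ _ _ one_ne_zero) (Real.exp_pos _)
  have hk0 : ∀ x, 0 ≤ k x := fun x => mul_nonneg (q x).2 (Real.exp_pos _).le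
  have hρf : gaussianReal 0 1 = targetMeasure.withDensity fun x => ENNReal.ofReal (f x) :=
    gaussianReal_eq_targetMeasure_withDensity
  have hνk : ν = targetMeasure.withDensity fun x => ENNReal.ofReal (k x) := by
    rw [← withDensity_eq_targetMeasure_withDensity hq.coe_nnreal_real]
    simp [hνdef]
  -- `q` times a continuous function is bounded
  have hbdd : ∀ u : ℝ → ℝ, Continuous u → ∃ B, ∀ x, |(q x : ℝ) * u x| ≤ B := by
    intro u hu
    obtain ⟨B, hB⟩ := hqc.isCompact.exists_bound_of_continuousOn hu.continuousOn
    refine ⟨M * max B 0, fun x => ?_⟩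
    by_cases hx : x ∈ tsupport q
    · rw [abs_mul]
      refine mul_le_mul ?_ ((hB x hx).trans (le_max_left _ _)) (abs_nonneg _) M.2
      exact (abs_of_nonneg (q x).2).trans_le (NNReal.coe_le_coe.2 (hM x))
    · rw [image_eq_zero_of_notMem_tsupport hx]
      simpa using mul_nonneg M.2 (le_max_right B 0)
  have hintb : ∀ u : ℝ → ℝ, Measurable u → (∃ B, ∀ x, |u x| ≤ B) → Integrable u targetMeasure := by
    rintro u hu ⟨B, hB⟩
    exact Integrable.of_bound hu.aestronglyMeasurable B (ae_of_all _ hB)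
  have hkb := hbdd _ (by fun_prop : Continuous fun x => Real.exp (potentialU x))
  have hki : Integrable k targetMeasure := hintb k hkm hkb
  have hgk : Integrable (fun x => k x * (x ^ 4 / 4)) targetMeasure := by
    refine hintb _ (by fun_prop) ?_
    obtain ⟨B, hB⟩ := hbdd (fun x => Real.exp (potentialU x) * (x ^ 4 / 4)) (by fun_prop)
    exact ⟨B, fun x => by simpa only [hkdef, mul_assoc] using hB x⟩
  have hfi : Integrable f targetMeasure := by
    have : Integrable (fun _ : ℝ => (1 : ℝ)) (gaussianReal 0 1) := integrable_const _
    rw [hρf, integrable_withDensity_ofReal_iff hfm fun x => (hf0 x).le] at this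
    simpa using this
  have hgf : Integrable (fun x => f x * (x ^ 4 / 4)) targetMeasure := by
    rwa [hρf, integrable_withDensity_ofReal_iff hfm fun x => (hf0 x).le] at hgi
  have hif : Integrable (fun x => klFun (f x)) targetMeasure := by
    have : (fun x => klFun (f x)) = fun x => f x * (x ^ 4 / 4) + κ * f x + 1 - f x := by
      ext x
      rw [klFun_apply, hκ]
      ring
    rw [this]
    exact ((hgf.add (hfi.const_mul κ)).add (integrable_const 1)).sub hfi
  have hik : Integrable (fun x => klFun (k x)) targetMeasure := by
    obtain ⟨B, hB⟩ := hkb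
    obtain ⟨B', hB'⟩ := (isCompact_Icc (a := -B) (b := B)).exists_bound_of_continuousOn
      continuous_klFun.continuousOn
    exact hintb _ (measurable_klFun.comp hkm) ⟨B', fun x => hB' _ (abs_le.1 (hB x))⟩
  have hl : Integrable (fun x => Real.log (f x) * (k x - f x)) targetMeasure := by
    have : (fun x => Real.log (f x) * (k x - f x)) = fun x =>
        (k x * (x ^ 4 / 4) + κ * k x) - (f x * (x ^ 4 / 4) + κ * f x) := by
      ext x
      rw [hκ]
      ring
    rw [this]
    exact (hgk.add (hki.const_mul κ)).sub (hgf.add (hfi.const_mul κ))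
  have hmix : ∀ ε ∈ Set.Icc (0 : ℝ) 1, energyF (mix (gaussianReal 0 1) ν ε) =
      ENNReal.ofReal (∫ x, klFun ((1 - ε) * f x + ε * k x) ∂targetMeasure) := by
    intro ε hε
    have h1 : 0 ≤ 1 - ε := by linarith [hε.2]
    have hpos : ∀ x, 0 ≤ (1 - ε) * f x + ε * k x := fun x =>
      add_nonneg (mul_nonneg h1 (hf0 x).le) (mul_nonneg hε.1 (hk0 x))
    have hm : mix (gaussianReal 0 1) ν ε =
        targetMeasure.withDensity fun x => ENNReal.ofReal ((1 - ε) * f x + ε * k x) := by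
      rw [mix, hρf, hνk, ← withDensity_smul _ (by fun_prop), ← withDensity_smul _ (by fun_prop),
        ← withDensity_add_left (by fun_prop)]
      congr 1
      ext x
      simp only [Pi.add_apply, Pi.smul_apply, smul_eq_mul]
      rw [← ENNReal.ofReal_mul h1, ← ENNReal.ofReal_mul hε.1,
        ENNReal.ofReal_add (mul_nonneg h1 (hf0 x).le) (mul_nonneg hε.1 (hk0 x))]
    rw [energyF, hm, klDiv_withDensity_ofReal (by fun_prop) hpos
      ((hfi.const_mul _).add (hki.const_mul _)), ofReal_integral_eq_lintegral_ofReal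
      (integrable_klFun_mix hfm hkm (fun x => (hf0 x).le) hk0 hif hik hε)
      (ae_of_all _ fun x => klFun_nonneg (hpos x))]
  have hgν : Integrable (fun x : ℝ => x ^ 4 / 4) ν := by
    rwa [hνk, integrable_withDensity_ofReal_iff hkm hk0]
  refine ⟨hgν, fun ε hε => by rw [hmix ε hε]; exact ENNReal.ofReal_lt_top, ?_⟩
  have hder := hasDerivWithinAt_integral_klFun_mix hfm hkm hf0 hk0 hif hik hl
  -- The constant `κ` drops out because `k` and `f` both have mass one.
  have hval : ∫ x, Real.log (f x) * (k x - f x) ∂targetMeasure =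
      ∫ x, x ^ 4 / 4 ∂ν - ∫ x, x ^ 4 / 4 ∂(gaussianReal 0 1) := by
    have hk1 : ∫ x, k x ∂targetMeasure = 1 := by
      have := integral_withDensity_ofReal (π := targetMeasure) hkm hk0 fun _ => 1
      rw [← hνk] at this
      simpa using this.symm
    have hf1 : ∫ x, f x ∂targetMeasure = 1 := by
      have := integral_withDensity_ofReal (π := targetMeasure) hfm (fun x => (hf0 x).le) fun _ => 1
      rw [← hρf] at this
      simpa using this.symm
    rw [hνk, hρf, integral_withDensity_ofReal hkm hk0, integral_withDensity_ofReal hfm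
      fun x => (hf0 x).le]
    have : (fun x => Real.log (f x) * (k x - f x)) = fun x =>
        (k x * (x ^ 4 / 4) + κ * k x) - (f x * (x ^ 4 / 4) + κ * f x) := by
      ext x
      rw [hκ]
      ring
    have hkadd : Integrable (fun x => k x * (x ^ 4 / 4) + κ * k x) targetMeasure :=
      hgk.add (hki.const_mul κ)
    have hfadd : Integrable (fun x => f x * (x ^ 4 / 4) + κ * f x) targetMeasure :=
      hgf.add (hfi.const_mul κ)
    rw [this, integral_sub hkadd hfadd,
      integral_add hgk (hki.const_mul κ), integral_add hgf (hfi.const_mul κ),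
      integral_const_mul, integral_const_mul, hk1, hf1]
    ring
  rw [← hval]
  refine hder.congr_of_mem (fun ε hε => ?_) ⟨le_rfl, zero_le_one⟩
  rw [hmix ε hε, ENNReal.toReal_ofReal]
  refine integral_nonneg fun x => klFun_nonneg ?_
  exact add_nonneg (mul_nonneg (by linarith [hε.2]) (hf0 x).le) (mul_nonneg hε.1 (hk0 x))

/-- Two continuous first variations of the same functional differ by a constant. -/
lemma IsFirstVariation.exists_eq_add_const {F : Measure ℝ → ℝ≥0∞} {ρ : Measure ℝ} {g g' : ℝ → ℝ}
    (hg : IsFirstVariation F ρ g) (hg' : IsFirstVariation F ρ g') (hc : Continuous g)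
    (hc' : Continuous g') : ∃ K, ∀ x, g x = g' x + K := by
  set K := ∫ x, g x ∂ρ - ∫ x, g' x ∂ρ
  refine ⟨K, ?_⟩
  -- Testing with the uniform law on `[a, b]` and equating the two one-sided derivatives shows that
  -- `g - g'` has mean `K` on every interval.
  have hint : ∀ a b : ℝ, a < b → ∫ x in a..b, (g x - g' x - K) = 0 := by
    intro a b hab
    set C : ℝ≥0 := Real.toNNReal (b - a)⁻¹
    have hC : (C : ℝ) = (b - a)⁻¹ := Real.coe_toNNReal _ (by simp; linarith)
    set q : ℝ → ℝ≥0 := (Set.Icc a b).indicator fun _ => C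
    set ν := volume.withDensity fun x => (q x : ℝ≥0∞)
    have hνeq : ν = (C : ℝ≥0∞) • volume.restrict (Set.Icc a b) := by
      have : (fun x => (q x : ℝ≥0∞)) = (Set.Icc a b).indicator fun _ => (C : ℝ≥0∞) := by
        ext x
        by_cases hx : x ∈ Set.Icc a b <;> simp [q, hx]
      simp only [ν]
      rw [this, withDensity_indicator measurableSet_Icc, withDensity_const]
    have hν : IsBoundedCompactDensity ν := by
      refine ⟨⟨?_⟩, q, measurable_const.indicator measurableSet_Icc, ⟨C, fun x => ?_⟩, ?_, rfl⟩
      · rw [hνeq]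
        simp only [Measure.smul_apply, MeasurableSet.univ, Measure.restrict_apply, Set.univ_inter,
          Real.volume_Icc, smul_eq_mul]
        change ENNReal.ofReal (b - a)⁻¹ * _ = 1
        rw [← ENNReal.ofReal_mul (by simp; linarith), inv_mul_cancel₀ (by linarith)]
        simp
      · exact Set.indicator_le_self' (by simp) x
      · exact HasCompactSupport.intro (isCompact_Icc (a := a) (b := b)) fun x hx => by
          simp only [q, Set.indicator_of_notMem hx]
    have hu := uniqueDiffOn_Icc (zero_lt_one' ℝ) 0 ⟨le_rfl, zero_le_one⟩
    have heq := hu.eq_deriv _ (hg.2 ν hν).2.2 (hg'.2 ν hν).2.2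
    rw [hνeq, integral_smul_measure, integral_smul_measure] at heq
    simp only [ENNReal.coe_toReal, smul_eq_mul, hC] at heq
    rw [integral_Icc_eq_integral_Ioc, integral_Icc_eq_integral_Ioc,
      ← intervalIntegral.integral_of_le hab.le, ← intervalIntegral.integral_of_le hab.le] at heq
    have hsub : Continuous fun x => g x - g' x := hc.sub hc'
    rw [intervalIntegral.integral_sub (hsub.intervalIntegrable _ _)
      intervalIntegrable_const,
      intervalIntegral.integral_sub (hc.intervalIntegrable _ _) (hc'.intervalIntegrable _ _)]
    have hba : b - a ≠ 0 := by linarith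
    have : ∫ x in a..b, g x = (∫ x in a..b, g' x) + (b - a) * K := by
      have hK : K = (b - a)⁻¹ * (∫ x in a..b, g x) - (b - a)⁻¹ * ∫ x in a..b, g' x := by
        simp only [K]; linarith
      rw [hK]
      field_simp
      ring
    rw [this]
    simp
  intro x
  have hw : Continuous fun x => g x - g' x - K := by fun_prop
  -- The base point `x - 1` lies strictly below every `u` near `x`, so the primitive vanishes in a
  -- full neighbourhood of `x`.
  have h1 := (hw.integral_hasStrictDerivAt (x - 1) x).hasDerivAt
  have h2 : (fun u => ∫ t in (x - 1)..u, (g t - g' t - K)) =ᶠ[𝓝 x] fun _ => 0 := by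
    filter_upwards [lt_mem_nhds (sub_one_lt x)] with u hu using hint _ _ hu
  have h3 := h1.unique ((hasDerivAt_const x (0 : ℝ)).congr_of_eventuallyEq h2)
  linarith

lemma isW2Gradient_cube : IsW2Gradient energyF (gaussianReal 0 1) fun x => x ^ 3 := by
  refine ⟨_, isFirstVariation_quartic, fun x => ?_⟩
  have := (hasDerivAt_pow 4 x).div_const 4
  refine this.congr_deriv ?_
  norm_num

lemma IsW2Gradient.eq_cube {v : ℝ → ℝ} (hv : IsW2Gradient energyF (gaussianReal 0 1) v) (x : ℝ) :
    v x = x ^ 3 := by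
  obtain ⟨g, hg, hd⟩ := hv
  obtain ⟨K, hK⟩ := hg.exists_eq_add_const isFirstVariation_quartic
    (continuous_iff_continuousAt.2 fun x => (hd x).continuousAt) (by fun_prop)
  have h : HasDerivAt g (x ^ 3) x := by
    have := ((hasDerivAt_pow 4 x).div_const 4).add_const K
    rw [funext hK]
    refine this.congr_deriv ?_
    norm_num
  exact (hd x).unique h

end Target

/-! ### Blow-up of a density against its distributional derivative. -/

section WeakDerivative

lemma hasDerivAt_smoothTransition (x : ℝ) :
    HasDerivAt Real.smoothTransition (deriv Real.smoothTransition x) x :=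
  (Real.smoothTransition.contDiff.differentiable (by simp : (1 : WithTop ℕ∞) ≠ 0) x).hasDerivAt

lemma continuous_deriv_smoothTransition : Continuous (deriv Real.smoothTransition) :=
  Real.smoothTransition.contDiff.continuous_deriv le_rfl

lemma deriv_smoothTransition_nonneg (x : ℝ) : 0 ≤ deriv Real.smoothTransition x :=
  Real.smoothTransition.monotone.deriv_nonneg

lemma deriv_smoothTransition_eq_zero {x : ℝ} (hx : x ∉ Set.Icc (0 : ℝ) 1) :
    deriv Real.smoothTransition x = 0 := by
  rw [Set.mem_Icc, not_and_or, not_le, not_le] at hx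
  rcases hx with hx | hx
  · have : Real.smoothTransition =ᶠ[𝓝 x] fun _ => 0 := by
      filter_upwards [gt_mem_nhds hx] with y hy using Real.smoothTransition.zero_of_nonpos hy.le
    simpa using this.deriv_eq
  · have : Real.smoothTransition =ᶠ[𝓝 x] fun _ => 1 := by
      filter_upwards [lt_mem_nhds hx] with y hy using Real.smoothTransition.one_of_one_le hy.le
    simpa using this.deriv_eq

/-- A smooth step rising from `0` at `a` to `1` at `a + d`. -/
noncomputable def smoothStep (a d x : ℝ) : ℝ := Real.smoothTransition ((x - a) / d)

/-- The derivative of `smoothStep`. -/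
noncomputable def smoothStepDeriv (a d x : ℝ) : ℝ := deriv Real.smoothTransition ((x - a) / d) / d

variable {a d x : ℝ}

lemma contDiff_smoothStep : ContDiff ℝ ∞ (smoothStep a d) :=
  Real.smoothTransition.contDiff.comp (by fun_prop)

lemma hasDerivAt_smoothStep : HasDerivAt (smoothStep a d) (smoothStepDeriv a d x) x := by
  have := (hasDerivAt_smoothTransition ((x - a) / d)).comp x
    (((hasDerivAt_id x).sub_const a).div_const d)
  refine this.congr_deriv ?_
  rw [smoothStepDeriv, mul_one_div]

lemma continuous_smoothStepDeriv : Continuous (smoothStepDeriv a d) :=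
  (continuous_deriv_smoothTransition.comp (by fun_prop)).div_const d

lemma smoothStepDeriv_nonneg (hd : 0 < d) : 0 ≤ smoothStepDeriv a d x :=
  div_nonneg (deriv_smoothTransition_nonneg _) hd.le

lemma smoothStepDeriv_eq_zero (hd : 0 < d) (hx : x ∉ Set.Icc a (a + d)) :
    smoothStepDeriv a d x = 0 := by
  rw [smoothStepDeriv, deriv_smoothTransition_eq_zero, zero_div]
  contrapose hx
  rw [Set.mem_Icc, le_div_iff₀ hd, div_le_iff₀ hd] at hx
  constructor <;> linarith [hx.1, hx.2]

lemma hasCompactSupport_smoothStepDeriv (hd : 0 < d) : HasCompactSupport (smoothStepDeriv a d) :=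
  HasCompactSupport.intro isCompact_Icc fun _ => smoothStepDeriv_eq_zero hd

lemma smoothStep_of_le (hd : 0 < d) (hx : x ≤ a) : smoothStep a d x = 0 :=
  Real.smoothTransition.zero_of_nonpos (div_nonpos_of_nonpos_of_nonneg (by linarith) hd.le)

lemma smoothStep_of_ge (hd : 0 < d) (hx : a + d ≤ x) : smoothStep a d x = 1 :=
  Real.smoothTransition.one_of_one_le ((one_le_div hd).2 (by linarith))

lemma integral_smoothStepDeriv (hd : 0 < d) : ∫ x, smoothStepDeriv a d x = 1 := by
  rw [integral_of_hasDerivAt_of_tendsto (f := smoothStep a d) (m := 0) (n := 1)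
    (fun x => hasDerivAt_smoothStep)
    (continuous_smoothStepDeriv.integrable_of_hasCompactSupport
      (hasCompactSupport_smoothStepDeriv hd)), sub_zero]
  · exact tendsto_const_nhds.congr' <| (eventually_le_atBot a).mono fun x hx =>
      (smoothStep_of_le hd hx).symm
  · exact tendsto_const_nhds.congr' <| (eventually_ge_atTop (a + d)).mono fun x hx =>
      (smoothStep_of_ge hd hx).symm

/-- If `p` blows up on the left of `c`, then the distributional derivative of `p` is not bounded
on test functions of sup norm at most one supported in `[c - 2, c]`. -/
lemma exists_test_lt_integral_mul_deriv {p : ℝ → ℝ} (hp : LocallyIntegrable p volume) {c : ℝ}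
    (hblow : ∀ M : ℝ, ∃ δ > 0, ∀ᵐ x, x ∈ Set.Ioo (c - δ) c → M ≤ p x) (K : ℝ) :
    ∃ φ : ℝ → ℝ, ContDiff ℝ ∞ φ ∧ (∀ x, |φ x| ≤ 1) ∧ (∀ x ∉ Set.Icc (c - 2) c, φ x = 0) ∧
      K < ∫ x, p x * deriv φ x := by
  -- `A` is what the fixed gentle step contributes; the level `K + A + 1` compensates for it.
  set A := ∫ x, p x * smoothStepDeriv (c - 2) 1 x
  obtain ⟨δ, hδ, hM⟩ := hblow (K + A + 1)
  obtain ⟨d, hd, hd1, hdδ⟩ : ∃ d : ℝ, 0 < d ∧ d < 1 ∧ 2 * d < δ :=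
    ⟨min (1 / 2) (δ / 4), by positivity, (min_le_left _ _).trans_lt (by norm_num),
      by linarith [min_le_right (1 / 2) (δ / 4)]⟩
  have hint : ∀ {a d : ℝ}, 0 < d → Integrable fun x => p x * smoothStepDeriv a d x := by
    intro a d hd
    simpa only [smul_eq_mul, mul_comm] using
      hp.integrable_smul_left_of_hasCompactSupport continuous_smoothStepDeriv
        (hasCompactSupport_smoothStepDeriv hd)
  have hder : ∀ x, HasDerivAt (fun x => smoothStep (c - 2 * d) d x - smoothStep (c - 2) 1 x)
      (smoothStepDeriv (c - 2 * d) d x - smoothStepDeriv (c - 2) 1 x) x :=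
    fun x => hasDerivAt_smoothStep.sub hasDerivAt_smoothStep
  -- This `φ` descends to `-1` over `[c - 2, c - 1]` and climbs back to `0` over `[c - 2d, c - d]`.
  -- The climb has derivative of mass one located where `p ≥ K + A + 1`.
  refine ⟨fun x => smoothStep (c - 2 * d) d x - smoothStep (c - 2) 1 x,
    contDiff_smoothStep.sub contDiff_smoothStep, fun x => ?_, fun x hx => ?_, ?_⟩
  · exact abs_sub_le_of_nonneg_of_le (Real.smoothTransition.nonneg _)
      (Real.smoothTransition.le_one _) (Real.smoothTransition.nonneg _)
      (Real.smoothTransition.le_one _)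
  · rw [Set.mem_Icc, not_and_or, not_le, not_le] at hx
    beta_reduce
    rcases hx with hx | hx
    · rw [smoothStep_of_le hd (by linarith), smoothStep_of_le one_pos hx.le, sub_zero]
    · rw [smoothStep_of_ge hd (by linarith), smoothStep_of_ge one_pos (by linarith), sub_self]
  · simp_rw [(hder _).deriv, mul_sub]
    rw [integral_sub (hint hd) (hint one_pos)]
    have : (K + A + 1) * 1 ≤ ∫ x, p x * smoothStepDeriv (c - 2 * d) d x := by
      rw [← integral_smoothStepDeriv (a := c - 2 * d) hd, ← integral_const_mul,
        integral_smoothStepDeriv hd]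
      refine integral_mono_ae ((continuous_smoothStepDeriv.integrable_of_hasCompactSupport
        (hasCompactSupport_smoothStepDeriv hd)).const_mul _) (hint hd) ?_
      filter_upwards [hM] with x hx
      by_cases hxI : x ∈ Set.Icc (c - 2 * d) (c - 2 * d + d)
      · exact mul_le_mul_of_nonneg_right (hx ⟨by linarith [hxI.1], by linarith [hxI.2]⟩)
          (smoothStepDeriv_nonneg hd)
      · simp [smoothStepDeriv_eq_zero hd hxI]
    linarith

/-- A weak derivative `q` would give `∫ p φ' ≤ ∫ |q|` over `[c - 2, c]`, uniformly in the test
functions above. -/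
lemma not_memW11loc_of_blowup {p : ℝ → ℝ} {c : ℝ}
    (hblow : ∀ M : ℝ, ∃ δ > 0, ∀ᵐ x, x ∈ Set.Ioo (c - δ) c → M ≤ p x) : ¬ MemW11loc p := by
  rintro ⟨hp, q, hq, h⟩
  obtain ⟨φ, hφ, hφ1, hφ0, hlt⟩ :=
    exists_test_lt_integral_mul_deriv hp hblow (∫ x in Set.Icc (c - 2) c, |q x|)
  have hqi := hq.integrableOn_isCompact (isCompact_Icc (a := c - 2) (b := c))
  refine hlt.not_ge ?_
  rw [h φ hφ (HasCompactSupport.intro isCompact_Icc hφ0),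
    ← setIntegral_eq_integral_of_forall_compl_eq_zero (s := Set.Icc (c - 2) c)
      fun x hx => by rw [hφ0 x hx, mul_zero]]
  refine (neg_le_abs _).trans ?_
  rw [← Real.norm_eq_abs]
  refine norm_integral_le_of_norm_le hqi.abs (ae_of_all _ fun x => ?_)
  rw [Real.norm_eq_abs, abs_mul]
  exact mul_le_of_le_one_right (abs_nonneg _) (hφ1 x)

end WeakDerivative

/-! ### Small transports: their cost and their effect on the energy. -/

section Slope

/-- The plan `(Id, G)` moves no point farther than `t`. -/
lemma W2_map_le {μ : Measure ℝ} [IsProbabilityMeasure μ] {G : ℝ → ℝ} (hG : Measurable G) {t : ℝ}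
    (h : ∀ x, |x - G x| ≤ t) : W2 μ (μ.map G) ≤ ENNReal.ofReal t := by
  have ht : 0 ≤ t := (abs_nonneg _).trans (h 0)
  have hmem : μ.map (fun x => (x, G x)) ∈ couplings μ (μ.map G) := by
    constructor
    · rw [Measure.map_map measurable_fst (by fun_prop)]
      exact Measure.map_id
    · rw [Measure.map_map measurable_snd (by fun_prop)]
      rfl
  have hle : ∫⁻ z, edist z.1 z.2 ^ 2 ∂(μ.map fun x => (x, G x)) ≤ ENNReal.ofReal t ^ 2 := by
    rw [lintegral_map (by fun_prop) (by fun_prop)]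
    calc ∫⁻ x, edist x (G x) ^ 2 ∂μ ≤ ∫⁻ _, ENNReal.ofReal t ^ 2 ∂μ := by
          refine lintegral_mono fun x => ?_
          gcongr
          rw [edist_dist, Real.dist_eq]
          exact ENNReal.ofReal_le_ofReal (h x)
      _ = ENNReal.ofReal t ^ 2 := by simp
  calc W2 μ (μ.map G) ≤ (ENNReal.ofReal t ^ 2) ^ (1 / 2 : ℝ) :=
        ENNReal.rpow_le_rpow ((biInf_le _ hmem).trans hle) (by norm_num)
    _ = ENNReal.ofReal t := by
        rw [← ENNReal.rpow_natCast, ← ENNReal.rpow_mul]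
        norm_num

lemma map_mem_P2 {μ : Measure ℝ} (hμ : μ ∈ P2) {G : ℝ → ℝ} (hG : Measurable G) {t : ℝ}
    (h : ∀ x, |x - G x| ≤ t) : μ.map G ∈ P2 := by
  have := hμ.1
  refine ⟨Measure.isProbabilityMeasure_map hG.aemeasurable, ?_⟩
  rw [lintegral_map (by fun_prop) hG]
  calc ∫⁻ x, ‖G x‖ₑ ^ 2 ∂μ ≤ ∫⁻ x, 2 * ‖x‖ₑ ^ 2 + 2 * ENNReal.ofReal t ^ 2 ∂μ := by
        refine lintegral_mono fun x => ?_
        have h1 : ‖G x‖ₑ ≤ ‖x‖ₑ + ENNReal.ofReal t := by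
          rw [Real.enorm_eq_ofReal_abs, Real.enorm_eq_ofReal_abs,
            ← ENNReal.ofReal_add (abs_nonneg _) ((abs_nonneg _).trans (h x))]
          refine ENNReal.ofReal_le_ofReal ?_
          have := abs_sub_abs_le_abs_sub (G x) x
          rw [abs_sub_comm] at this
          linarith [h x]
        calc ‖G x‖ₑ ^ 2 ≤ (‖x‖ₑ + ENNReal.ofReal t) ^ 2 := by gcongr
          _ ≤ 2 * ‖x‖ₑ ^ 2 + 2 * ENNReal.ofReal t ^ 2 := by
            have := ENNReal.rpow_add_le_mul_rpow_add_rpow ‖x‖ₑ (ENNReal.ofReal t)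
              (p := 2) one_le_two
            norm_num at this
            simpa [mul_add] using this
    _ < ⊤ := by
        rw [lintegral_add_right _ measurable_const, lintegral_const_mul _ (by fun_prop)]
        simp only [lintegral_const, measure_univ, mul_one]
        exact ENNReal.add_lt_top.2 ⟨ENNReal.mul_lt_top (by simp) hμ.2,
          ENNReal.mul_lt_top (by simp) (by simp)⟩

/-- A measure in the slope domain satisfies a local one-sided Lipschitz bound. -/
lemma exists_le_add_of_mem_slopeDomain {F : Measure ℝ → ℝ≥0∞} {μ : Measure ℝ}
    (hμ : μ ∈ slopeDomain F) : ∃ S : ℝ≥0, ∃ r : ℝ≥0∞, 0 < r ∧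
      ∀ ν ∈ P2, W2 μ ν < r → F μ ≤ F ν + S * W2 μ ν := by
  obtain ⟨-, -, h⟩ := hμ
  obtain ⟨r, h⟩ := iInf_lt_iff.1 h
  obtain ⟨hr, h⟩ := iInf_lt_iff.1 h
  lift (⨆ (ν : Measure ℝ) (_ : ν ∈ P2) (_ : ν ≠ μ) (_ : W2 μ ν < r), (F μ - F ν) / W2 μ ν)
    to ℝ≥0 using h.ne with S hS
  refine ⟨S, r, hr, fun ν hν hW => ?_⟩
  by_cases hne : ν = μ
  · rw [hne]
    exact le_self_add
  have h1 : (F μ - F ν) / W2 μ ν ≤ S := by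
    rw [hS]
    exact le_iSup₂_of_le ν hν (le_iSup₂_of_le hne hW le_rfl)
  -- Finiteness of `S` covers `W2 μ ν = 0`, and `W2 μ ν < r` excludes an infinite distance.
  rw [ENNReal.div_le_iff_le_mul (Or.inr ENNReal.coe_ne_top) (Or.inl (hW.trans_le le_top).ne)] at h1
  exact tsub_le_iff_left.1 h1

/-- The log-density of the pullback of the target measure under the map `G` with derivative `G'`,
relative to the target measure. -/
noncomputable def logPullback (G G' : ℝ → ℝ) (x : ℝ) : ℝ :=
  Real.log (G' x) - (potentialU (G x) - potentialU x)

lemma map_targetMeasure_withDensity {G G' : ℝ → ℝ} (hd : ∀ x, HasDerivAt G (G' x) x)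
    (hpos : ∀ x, 0 < G' x) (hG' : Measurable G') (hsurj : Function.Surjective G) :
    (targetMeasure.withDensity fun x => ENNReal.ofReal (Real.exp (logPullback G G' x))).map G =
      targetMeasure := by
  have hGc : Continuous G := continuous_iff_continuousAt.2 fun x => (hd x).continuousAt
  have hU := continuous_potentialU
  have hinj : Function.Injective G :=
    (strictMono_of_deriv_pos fun x => by rw [(hd x).deriv]; exact hpos x).injective
  ext s hs
  rw [Measure.map_apply hGc.measurable hs, targetMeasure,
    ← withDensity_mul _ (by fun_prop) (by unfold logPullback; fun_prop),
    withDensity_apply _ (hGc.measurable hs), withDensity_apply _ hs,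
    ← Set.image_preimage_eq s hsurj, lintegral_image_eq_lintegral_abs_deriv_mul
      (hGc.measurable hs) (fun x _ => (hd x).hasDerivWithinAt) hinj.injOn,
    Set.preimage_image_eq _ hinj]
  refine lintegral_congr fun x => ?_
  rw [Pi.mul_apply, ← ENNReal.ofReal_mul (Real.exp_pos _).le, ← ENNReal.ofReal_mul (abs_nonneg _),
    abs_of_pos (hpos x), logPullback, ← Real.exp_add]
  congr 1
  nth_rewrite 2 [← Real.exp_log (hpos x)]
  rw [← Real.exp_add]
  ring_nf

/-- Write the target as the image under `G` of the target tilted by `logPullback`. Data processing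
bounds the new energy by the divergence of `ρ` from the tilted measure, which is the old energy
minus the integral of `logPullback`. No density of `ρ.map G` is needed. -/
lemma energyF_map_add_le {ρ : Measure ℝ} [IsProbabilityMeasure ρ] (hρ : energyF ρ < ⊤)
    {G G' : ℝ → ℝ} (hd : ∀ x, HasDerivAt G (G' x) x)
    (hpos : ∀ x, 0 < G' x) (hG' : Measurable G') (hsurj : Function.Surjective G)
    (hfi : Integrable (logPullback G G') ρ) :
    energyF (ρ.map G) < ⊤ ∧
      (energyF (ρ.map G)).toReal + ∫ x, logPullback G G' x ∂ρ ≤ (energyF ρ).toReal := by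
  have hGc : Continuous G := continuous_iff_continuousAt.2 fun x => (hd x).continuousAt
  have hU := continuous_potentialU
  have hfm : Measurable (logPullback G G') := by unfold logPullback; fun_prop
  have hmap := map_targetMeasure_withDensity hd hpos hG' hsurj
  obtain ⟨hac, hll⟩ := klDiv_ne_top_iff.1 hρ.ne
  have hone : ∫⁻ x, ENNReal.ofReal (Real.exp (logPullback G G' x)) ∂targetMeasure = 1 := by
    have := congrArg (fun μ => μ Set.univ) hmap
    simpa [Measure.map_apply hGc.measurable MeasurableSet.univ] using this
  have hexp : Integrable (fun x => Real.exp (logPullback G G' x)) targetMeasure := by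
    refine ⟨by fun_prop, ?_⟩
    rw [hasFiniteIntegral_iff_ofReal (ae_of_all _ fun x => (Real.exp_pos _).le), hone]
    simp
  have hone' : ∫ x, Real.exp (logPullback G G' x) ∂targetMeasure = 1 := by
    rw [integral_eq_lintegral_of_nonneg_ae (ae_of_all _ fun x => (Real.exp_pos _).le)
      (by fun_prop), hone, ENNReal.toReal_one]
  have htilt : (targetMeasure.withDensity fun x => ENNReal.ofReal (Real.exp (logPullback G G' x))) =
      targetMeasure.tilted (logPullback G G') := by
    simp [Measure.tilted, hone']
  rw [htilt] at hmap
  have := isProbabilityMeasure_tilted hexp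
  have hac' : ρ ≪ targetMeasure.tilted (logPullback G G') :=
    hac.trans (absolutelyContinuous_tilted hexp)
  have hll' := integrable_llr_tilted_right hac hfi hll hexp
  have hle : energyF (ρ.map G) ≤ klDiv ρ (targetMeasure.tilted (logPullback G G')) := by
    have := klDiv_map_le ρ (targetMeasure.tilted (logPullback G G')) hGc.measurable
    rwa [hmap] at this
  have hne := klDiv_ne_top hac' hll'
  refine ⟨hle.trans_lt hne.lt_top, ?_⟩
  have h1 := ENNReal.toReal_mono hne hle
  rw [toReal_klDiv_of_measure_eq hac' (by simp), integral_llr_tilted_right hac hfi hexp hll,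
    hone', Real.log_one] at h1
  rw [energyF, energyF, toReal_klDiv_of_measure_eq hac (by simp)]
  rw [energyF] at h1
  linarith

end Slope

/-! ### Finite slope bounds the distributional derivative. -/

section SlopeBound

lemma sub_two_mul_sq_le_log {s : ℝ} (hs : -(1 / 2) ≤ s) : s - 2 * s ^ 2 ≤ Real.log (1 + s) := by
  have hpos : 0 < 1 + s := by linarith
  refine le_trans ?_ (Real.one_sub_inv_le_log_of_pos hpos)
  have : 1 - (1 + s)⁻¹ = s / (1 + s) := by field_simp; ring
  rw [this, le_div_iff₀ hpos]
  nlinarith [mul_nonneg (sq_nonneg s) (by linarith : 0 ≤ 1 + 2 * s)]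

lemma exists_potentialU_lipschitz (a b : ℝ) : ∃ L, ∀ x ∈ Set.Icc a b, ∀ y ∈ Set.Icc a b,
    |potentialU y - potentialU x| ≤ L * |y - x| := by
  have hd : ∀ x, HasDerivAt potentialU (x + x ^ 3) x := by
    intro x
    have := (((hasDerivAt_pow 2 x).div_const 2).add ((hasDerivAt_pow 4 x).div_const 4)).add_const
      (Real.log (∫ t : ℝ, Real.exp (-(t ^ 2 / 2) - t ^ 4 / 4)))
    refine this.congr_deriv ?_
    norm_num
  obtain ⟨L, hL⟩ := (isCompact_Icc (a := a) (b := b)).exists_bound_of_continuousOn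
    (f := fun x : ℝ => x + x ^ 3) (by fun_prop)
  exact ⟨L, fun x hx y hy => (convex_Icc a b).norm_image_sub_le_of_norm_hasDerivWithin_le
    (fun z _ => (hd z).hasDerivWithinAt) hL hx hy⟩

/-- At a point of the slope domain the distributional derivative is bounded on test functions
of sup norm at most one with a prescribed compact support. -/
lemma exists_integral_deriv_le_of_mem_slopeDomain {ρ : Measure ℝ} (hρ : ρ ∈ slopeDomain energyF)
    (c : ℝ) : ∃ K : ℝ, ∀ φ : ℝ → ℝ, ContDiff ℝ ∞ φ → (∀ x, |φ x| ≤ 1) →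
      (∀ x ∉ Set.Icc (c - 2) c, φ x = 0) → ∫ x, deriv φ x ∂ρ ≤ K := by
  obtain ⟨S, r, hr, hS⟩ := exists_le_add_of_mem_slopeDomain hρ
  obtain ⟨L, hL⟩ := exists_potentialU_lipschitz (c - 3) (c + 1)
  have hρP := hρ.1.1
  have hL0 : 0 ≤ L := by
    have := (abs_nonneg _).trans (hL c ⟨by linarith, by linarith⟩ (c + 1) ⟨by linarith, le_rfl⟩)
    simpa using this
  -- `S` comes from the slope, `1` from the quadratic error of the logarithm, `L` from the change of
  -- potential.
  refine ⟨S + 1 + L, fun φ hφ hφ1 hφ0 => ?_⟩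
  have hcs : HasCompactSupport φ := HasCompactSupport.intro isCompact_Icc hφ0
  have hdc : Continuous (deriv φ) := hφ.continuous_deriv (by simp)
  have hφc : Continuous φ := hφ.continuous
  have hφd : ∀ x, HasDerivAt φ (deriv φ x) x := fun x =>
    (hφ.differentiable (by simp) x).hasDerivAt
  obtain ⟨B, hB⟩ := hdc.bounded_above_of_compact_support hcs.deriv
  have hB0 : 0 ≤ B := (norm_nonneg _).trans (hB 0)
  obtain ⟨r', hr', hr'r⟩ := ENNReal.lt_iff_exists_nnreal_btwn.1 hr
  -- In turn: points of `[c - 2, c]` stay in the Lipschitz interval; `G` is increasing and the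
  -- logarithm estimate applies; the error `2(tB)²` is at most `t`; the image stays in the slope
  -- ball. The step `t` may depend on `B`, since it cancels at the end.
  obtain ⟨t, ht, ht1, htB, htB2, htr⟩ : ∃ t : ℝ, 0 < t ∧ t ≤ 1 ∧ t * B ≤ 1 / 2 ∧
      2 * (t * B ^ 2) ≤ 1 ∧ t ≤ r' := by
    have hr'' : (0 : ℝ) < r' := by exact_mod_cast hr'
    have hev : ∀ᶠ t : ℝ in 𝓝[>] 0, 0 < t ∧ t ≤ 1 ∧ t * B ≤ 1 / 2 ∧
        2 * (t * B ^ 2) ≤ 1 ∧ t ≤ r' := by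
      have h1 : Tendsto (fun t : ℝ => t * B) (𝓝[>] 0) (𝓝 0) := by
        have : Continuous fun t : ℝ => t * B := by fun_prop
        simpa using (this.tendsto 0).mono_left nhdsWithin_le_nhds
      have h2 : Tendsto (fun t : ℝ => 2 * (t * B ^ 2)) (𝓝[>] 0) (𝓝 0) := by
        have : Continuous fun t : ℝ => 2 * (t * B ^ 2) := by fun_prop
        simpa using (this.tendsto 0).mono_left nhdsWithin_le_nhds
      have h3 : Tendsto (fun t : ℝ => t) (𝓝[>] 0) (𝓝 0) := nhdsWithin_le_nhds
      filter_upwards [self_mem_nhdsWithin, h3.eventually_le_const one_pos,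
        h1.eventually_le_const one_half_pos, h2.eventually_le_const one_pos,
        h3.eventually_le_const hr''] with t a1 a2 a3 a4 a5 using ⟨a1, a2, a3, a4, a5⟩
    exact hev.exists
  set G : ℝ → ℝ := fun x => x + t * φ x with hG
  set G' : ℝ → ℝ := fun x => 1 + t * deriv φ x with hG'
  have htd : ∀ x, |t * deriv φ x| ≤ t * B := fun x => by
    rw [abs_mul, abs_of_pos ht]
    exact mul_le_mul_of_nonneg_left (hB x) ht.le
  have hd : ∀ x, HasDerivAt G (G' x) x := fun x =>
    (hasDerivAt_id x).add ((hφd x).const_mul t)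
  have hlow : ∀ x, -(1 / 2) ≤ t * deriv φ x := fun x => by
    linarith [(abs_le.1 (htd x)).1]
  have hpos : ∀ x, 0 < G' x := fun x => by
    simp only [hG']
    linarith [hlow x]
  have hGc : Continuous G := by fun_prop
  have hG'c : Continuous G' := by fun_prop
  have hdist : ∀ x, |x - G x| ≤ t := fun x => by
    rw [abs_sub_comm, hG, add_sub_cancel_left, abs_mul, abs_of_pos ht]
    exact mul_le_of_le_one_right ht.le (hφ1 x)
  have hsurj : Function.Surjective G := by
    refine hGc.surjective ?_ ?_
    · refine tendsto_atTop_mono (f := fun x => x + -t) (fun x => ?_)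
        (tendsto_atTop_add_const_right _ _ tendsto_id)
      linarith [(abs_le.1 (hdist x)).2]
    · refine tendsto_atBot_mono (f := fun x => x + t) (fun x => ?_)
        (tendsto_atBot_add_const_right _ _ tendsto_id)
      linarith [(abs_le.1 (hdist x)).1]
  have hU := continuous_potentialU
  have hder0 : ∀ x ∉ Set.Icc (c - 2) c, deriv φ x = 0 := fun x hx => by
    have : φ =ᶠ[𝓝 x] fun _ => 0 := by
      filter_upwards [isClosed_Icc.isOpen_compl.mem_nhds hx] with y hy using hφ0 y hy
    simpa using this.deriv_eq
  have hlc : Continuous (logPullback G G') :=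
    (hG'c.log fun x => (hpos x).ne').sub ((hU.comp hGc).sub hU)
  have hlcs : HasCompactSupport (logPullback G G') := by
    refine HasCompactSupport.intro (isCompact_Icc (a := c - 2) (b := c)) fun x hx => ?_
    simp [logPullback, hG, hG', hφ0 x hx, hder0 x hx]
  have hfi : Integrable (logPullback G G') ρ := hlc.integrable_of_hasCompactSupport hlcs
  have hge : ∀ x, t * deriv φ x - (t + L * t) ≤ logPullback G G' x := fun x => by
    have h1 := sub_two_mul_sq_le_log (hlow x)
    have h2 : 2 * (t * deriv φ x) ^ 2 ≤ t := by
      have : (t * deriv φ x) ^ 2 ≤ (t * B) ^ 2 := sq_le_sq.2 ((htd x).trans (le_abs_self _))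
      nlinarith
    have h3 : potentialU (G x) - potentialU x ≤ L * t := by
      by_cases hx : x ∈ Set.Icc (c - 2) c
      · have hGx := abs_le.1 (hdist x)
        refine (le_abs_self _).trans ((hL x ⟨by linarith [hx.1], by linarith [hx.2]⟩ (G x)
          ⟨by linarith [hx.1], by linarith [hx.2]⟩).trans ?_)
        rw [abs_sub_comm]
        exact mul_le_mul_of_nonneg_left (hdist x) hL0
      · simp only [hG, hφ0 x hx, mul_zero, add_zero, sub_self]
        positivity
    rw [logPullback]
    linarith
  obtain ⟨hfin, hle⟩ := energyF_map_add_le hρ.2.1 hd hpos hG'c.measurable hsurj hfi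
  have hW := W2_map_le (μ := ρ) hGc.measurable hdist
  have hWr : W2 ρ (ρ.map G) < r := by
    refine hW.trans_lt (lt_of_le_of_lt ?_ hr'r)
    exact ENNReal.ofReal_le_of_le_toReal htr
  have hF := hS _ (map_mem_P2 hρ.1 hGc.measurable hdist) hWr
  have hF' : (energyF ρ).toReal ≤ (energyF (ρ.map G)).toReal + S * t := by
    have h1 : energyF ρ ≤ energyF (ρ.map G) + S * ENNReal.ofReal t :=
      hF.trans (by gcongr)
    have h2 := ENNReal.toReal_mono (ENNReal.add_ne_top.2 ⟨hfin.ne, by finiteness⟩) h1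
    rwa [ENNReal.toReal_add hfin.ne (by finiteness), ENNReal.toReal_mul, ENNReal.coe_toReal,
      ENNReal.toReal_ofReal ht.le] at h2
  have hdi : Integrable (deriv φ) ρ := hdc.integrable_of_hasCompactSupport hcs.deriv
  have hI : t * ∫ x, deriv φ x ∂ρ - (t + L * t) ≤ ∫ x, logPullback G G' x ∂ρ := by
    have := integral_mono ((hdi.const_mul t).sub (integrable_const (t + L * t))) hfi hge
    simp only [Pi.sub_apply] at this
    rwa [integral_sub (hdi.const_mul t) (integrable_const _), integral_const_mul, integral_const,
      probReal_univ, one_smul] at this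
  have : t * ∫ x, deriv φ x ∂ρ ≤ t * (S + 1 + L) := by linarith
  exact le_of_mul_le_mul_left this ht

/-- A measure whose density blows up on the left of a point is not in the slope domain. -/
lemma notMem_slopeDomain_of_blowup {p : ℝ → ℝ} (hpm : Measurable p) (hp0 : ∀ x, 0 ≤ p x)
    (hp : LocallyIntegrable p volume) {c : ℝ}
    (hblow : ∀ M : ℝ, ∃ δ > 0, ∀ᵐ x, x ∈ Set.Ioo (c - δ) c → M ≤ p x) :
    (volume.withDensity fun x => ENNReal.ofReal (p x)) ∉ slopeDomain energyF := by
  intro h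
  obtain ⟨K, hK⟩ := exists_integral_deriv_le_of_mem_slopeDomain h c
  obtain ⟨φ, hφ, hφ1, hφ0, hlt⟩ := exists_test_lt_integral_mul_deriv hp hblow K
  have := hK φ hφ hφ1 hφ0
  rw [integral_withDensity_ofReal hpm hp0] at this
  exact hlt.not_ge this

end SlopeBound

/-! ### Densities of injective branches and limits through folds. -/

section Branches

/-- The density of the push-forward of `p dx` restricted to a set on which `T` is injective. -/
lemma exists_branch_density {T T' p : ℝ → ℝ} {I : Set ℝ} (hI : MeasurableSet I)
    (hT : ∀ x, HasDerivAt T (T' x) x) (hT' : Measurable T') (hinj : Set.InjOn T I)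
    (hne : ∀ x ∈ I, T' x ≠ 0) (hp : Measurable p) (hp0 : ∀ x, 0 ≤ p x) :
    ∃ b : ℝ → ℝ, Measurable b ∧ (∀ y, 0 ≤ b y) ∧ (∀ x ∈ I, b (T x) = p x / |T' x|) ∧
      (∀ y ∉ T '' I, b y = 0) ∧
      ((volume.withDensity fun x => ENNReal.ofReal (p x)).restrict I).map T =
        volume.withDensity fun y => ENNReal.ofReal (b y) := by
  have hTc : Continuous T := continuous_iff_continuousAt.2 fun x => (hT x).continuousAt
  obtain ⟨g, hg, hgT⟩ := (hTc.continuousOn.measurableEmbedding hI hinj).exists_measurable_extend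
    (g := fun x : I => p x / |T' x|)
    ((hp.div (hT'.norm)).comp measurable_subtype_coe) (fun _ => ⟨0⟩)
  have himg : MeasurableSet (T '' I) := hI.image_of_continuousOn_injOn hTc.continuousOn hinj
  have hbT : ∀ x ∈ I, (T '' I).indicator g (T x) = p x / |T' x| := fun x hx => by
    rw [Set.indicator_of_mem (Set.mem_image_of_mem T hx)]
    exact congrFun hgT ⟨x, hx⟩
  refine ⟨(T '' I).indicator g, hg.indicator himg, fun y => ?_, hbT,
    fun y hy => Set.indicator_of_notMem hy _, ?_⟩
  · by_cases hy : y ∈ T '' I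
    · obtain ⟨x, hx, rfl⟩ := hy
      rw [hbT x hx]
      exact div_nonneg (hp0 x) (abs_nonneg _)
    · rw [Set.indicator_of_notMem hy]
  · ext s hs
    have hTs := hTc.measurable hs
    have hcv := lintegral_image_eq_lintegral_abs_deriv_mul hI
      (fun x _ => (hT x).hasDerivWithinAt) hinj
      (s.indicator fun y => ENNReal.ofReal ((T '' I).indicator g y))
    rw [Measure.map_apply hTc.measurable hs, Measure.restrict_apply hTs,
      withDensity_apply _ (hTs.inter hI), withDensity_apply _ hs,
      ← setLIntegral_indicator hTs]
    have hF : (fun y => ENNReal.ofReal ((T '' I).indicator g y)) =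
        (T '' I).indicator fun y => ENNReal.ofReal ((T '' I).indicator g y) := by
      ext y
      by_cases hy : y ∈ T '' I <;> simp only [Set.indicator_of_mem, Set.indicator_of_notMem, hy,
        not_false_eq_true, ENNReal.ofReal_zero]
    rw [setLIntegral_indicator hs] at hcv
    rw [hF, setLIntegral_indicator himg, Set.inter_comm, hcv]
    refine setLIntegral_congr_fun hI fun x hx => ?_
    by_cases hxs : T x ∈ s
    · rw [Set.indicator_of_mem (show x ∈ T ⁻¹' s from hxs), Set.indicator_of_mem hxs, hbT x hx,
        ← ENNReal.ofReal_mul (abs_nonneg _), mul_div_cancel₀ _ (abs_ne_zero.2 (hne x hx))]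
    · rw [Set.indicator_of_notMem (show x ∉ T ⁻¹' s from hxs), Set.indicator_of_notMem hxs,
        mul_zero]

/-- By the intermediate value theorem, `f` maps left neighbourhoods of `a` onto sets containing left
neighbourhoods of `f a`. Limits of `b ∘ f` thus become limits of `b`, without an inverse of `f`. -/
lemma nhdsLT_le_map_nhdsLT {f : ℝ → ℝ} (hf : Continuous f) {a : ℝ}
    (h : ∀ᶠ x in 𝓝[<] a, f x < f a) : 𝓝[<] (f a) ≤ map f (𝓝[<] a) := by
  intro s hs
  obtain ⟨x₀, hx₀, hs'⟩ := mem_nhdsLT_iff_exists_Ioo_subset.1 (inter_mem (mem_map.1 hs) h)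
  obtain ⟨x₁, h1, h2⟩ := exists_between (Set.mem_Iio.1 hx₀)
  refine mem_of_superset (Ioo_mem_nhdsLT (hs' ⟨h1, h2⟩).2) ?_
  refine (intermediate_value_Ioo h2.le hf.continuousOn).trans ?_
  rintro _ ⟨x, hx, rfl⟩
  exact (hs' ⟨h1.trans hx.1, hx.2⟩).1

lemma nhdsGT_le_map_nhdsLT {f : ℝ → ℝ} (hf : Continuous f) {a : ℝ}
    (h : ∀ᶠ x in 𝓝[<] a, f a < f x) : 𝓝[>] (f a) ≤ map f (𝓝[<] a) := by
  intro s hs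
  obtain ⟨x₀, hx₀, hs'⟩ := mem_nhdsLT_iff_exists_Ioo_subset.1 (inter_mem (mem_map.1 hs) h)
  obtain ⟨x₁, h1, h2⟩ := exists_between (Set.mem_Iio.1 hx₀)
  refine mem_of_superset (Ioo_mem_nhdsGT (hs' ⟨h1, h2⟩).2) ?_
  refine (intermediate_value_Ioo' h2.le hf.continuousOn).trans ?_
  rintro _ ⟨x, hx, rfl⟩
  exact (hs' ⟨h1.trans hx.1, hx.2⟩).1

lemma not_continuousAt_of_ae_eq_tendsto_atTop {p p₁ : ℝ → ℝ} (h : p =ᵐ[volume] p₁) {c : ℝ}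
    {l : Filter ℝ} (hl : l ≤ 𝓝 c) (hpos : ∀ s ∈ l, volume s ≠ 0) (ht : Tendsto p₁ l atTop) :
    ¬ ContinuousAt p c := by
  intro hc
  have h1 : ∀ᶠ x in l, p x < p c + 1 := hl (hc.eventually_lt_const (lt_add_one _))
  have h2 : ∀ᶠ x in l, p c + 1 ≤ p₁ x := ht.eventually_ge_atTop _
  refine hpos _ (h1.and h2) (measure_mono_null ?_ h)
  intro x hx heq
  have : p x = p₁ x := heq
  linarith [hx.1, hx.2]

end Branches

/-! ### The folded Gaussian. -/

section Cubic

variable {h a : ℝ}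

lemma hasDerivAt_cubic (h x : ℝ) : HasDerivAt (fun x => x - h * x ^ 3) (1 - 3 * h * x ^ 2) x := by
  refine ((hasDerivAt_id x).sub ((hasDerivAt_pow 3 x).const_mul h)).congr_deriv ?_
  norm_num
  ring

/-- The critical value is attained doubly at `a` and simply at `-2a`; this sign pattern decides
which branches reach each side of it. -/
lemma cubic_sub_critical (ha : 3 * h * a ^ 2 = 1) (x : ℝ) :
    2 / 3 * a - (x - h * x ^ 3) = h * (x - a) ^ 2 * (x + 2 * a) := by
  linear_combination (2 / 3 * a - x) * (-ha)

lemma injOn_cubic {I : Set ℝ} (hI : ∀ x ∈ I, ∀ y ∈ I, h * (x ^ 2 + x * y + y ^ 2) ≠ 1) :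
    Set.InjOn (fun x => x - h * x ^ 3) I := by
  intro x hx y hy hxy
  have h0 : (x - y) * (1 - h * (x ^ 2 + x * y + y ^ 2)) = 0 := by
    linear_combination hxy
  rcases mul_eq_zero.1 h0 with h0 | h0
  · linarith
  · exact absurd (by linarith) (hI x hx y hy)

/-- The density of the push-forward of the standard Gaussian under `x ↦ x - h x³`. -/
lemma exists_density_map_cubic (hh : 0 < h) (ha0 : 0 < a) (ha : 3 * h * a ^ 2 = 1) :
    ∃ p : ℝ → ℝ, Measurable p ∧ (∀ y, 0 ≤ p y) ∧
      (gaussianReal 0 1).map (fun x => x - h * x ^ 3) =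
        volume.withDensity (fun y => ENNReal.ofReal (p y)) ∧
      Tendsto p (𝓝[<] (2 / 3 * a)) atTop ∧ (∃ L : ℝ, Tendsto p (𝓝[>] (2 / 3 * a)) (𝓝 L)) ∧
      Tendsto p (𝓝[>] (-(2 / 3 * a))) atTop ∧
      ∃ L : ℝ, Tendsto p (𝓝[<] (-(2 / 3 * a))) (𝓝 L) := by
  set T : ℝ → ℝ := fun x => x - h * x ^ 3 with hTdef
  set T' : ℝ → ℝ := fun x => 1 - 3 * h * x ^ 2 with hT'def
  set k : ℝ → ℝ := fun x => gaussianPDFReal 0 1 x / |T' x| with hk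
  have hT : ∀ x, HasDerivAt T (T' x) x := hasDerivAt_cubic h
  have hTc : Continuous T := by fun_prop
  have hT'c : Continuous T' := by fun_prop
  have hT'eq : ∀ x, T' x = 3 * h * (a - x) * (a + x) := fun x => by
    simp only [hT'def]
    linear_combination -ha
  have hGm := measurable_gaussianPDFReal 0 1
  have hG0 := gaussianPDFReal_nonneg 0 1
  have hGc : Continuous (gaussianPDFReal 0 1) := by
    rw [gaussianPDFReal_def]
    fun_prop
  have hkneg : ∀ x, k (-x) = k x := fun x => by
    simp [hk, hT'def, gaussianPDFReal]
  have hTneg : ∀ x, T (-x) = -T x := fun x => by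
    simp only [hTdef]
    ring
  have hcrit : ∀ x, 2 / 3 * a - T x = h * (x - a) ^ 2 * (x + 2 * a) := cubic_sub_critical ha
  have hTa : T a = 2 / 3 * a := by linarith [hcrit a, show h * (a - a) ^ 2 * (a + 2 * a) = 0 by ring]
  have hT2a : T (-(2 * a)) = 2 / 3 * a := by
    linarith [hcrit (-(2 * a)), show h * (-(2 * a) - a) ^ 2 * (-(2 * a) + 2 * a) = 0 by ring]
  have hTle : ∀ x, -a < x → T x ≤ 2 / 3 * a := fun x hx => by
    have : 0 ≤ h * (x - a) ^ 2 * (x + 2 * a) :=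
      mul_nonneg (mul_nonneg hh.le (sq_nonneg _)) (by linarith)
    linarith [hcrit x]
  have hTge : ∀ x, x < a → -(2 / 3 * a) ≤ T x := fun x hx => by
    have := hTle (-x) (by linarith)
    rw [hTneg] at this
    linarith
  obtain ⟨b₁, hb₁m, hb₁0, hb₁T, hb₁i, hb₁⟩ := exists_branch_density (I := Set.Iio (-a))
    measurableSet_Iio hT hT'c.measurable (injOn_cubic fun x hx y hy e => by
      have hx' : x < -a := hx
      have hy' : y < -a := hy
      -- Since `h * (3 * a ^ 2) = 1`, comparison with `3 * a ^ 2` decides the injectivity criterion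
      -- on each branch.
      have : 3 * a ^ 2 < x ^ 2 + x * y + y ^ 2 := by nlinarith
      nlinarith) (fun x hx => by
      rw [hT'eq]
      have hx' : x < -a := hx
      exact mul_ne_zero (mul_ne_zero (by positivity) (by linarith)) (by linarith)) hGm hG0
  obtain ⟨b₂, hb₂m, hb₂0, hb₂T, hb₂i, hb₂⟩ := exists_branch_density (I := Set.Ioo (-a) a)
    measurableSet_Ioo hT hT'c.measurable (injOn_cubic fun x hx y hy e => by
      have : x ^ 2 + x * y + y ^ 2 < 3 * a ^ 2 := by
        have h1 : x ^ 2 < a ^ 2 := sq_lt_sq' hx.1 hx.2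
        have h2 : y ^ 2 < a ^ 2 := sq_lt_sq' hy.1 hy.2
        nlinarith [sq_nonneg (x - y)]
      nlinarith) (fun x hx => by
      rw [hT'eq]
      have h1 := hx.1
      have h2 := hx.2
      exact mul_ne_zero (mul_ne_zero (by positivity) (by linarith)) (by linarith)) hGm hG0
  obtain ⟨b₃, hb₃m, hb₃0, hb₃T, hb₃i, hb₃⟩ := exists_branch_density (I := Set.Ioi a)
    measurableSet_Ioi hT hT'c.measurable (injOn_cubic fun x hx y hy e => by
      have hx' : a < x := hx
      have hy' : a < y := hy
      have : 3 * a ^ 2 < x ^ 2 + x * y + y ^ 2 := by nlinarith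
      nlinarith) (fun x hx => by
      rw [hT'eq]
      have hx' : a < x := hx
      exact mul_ne_zero (mul_ne_zero (by positivity) (by linarith)) (by linarith)) hGm hG0
  have hρ : (gaussianReal 0 1).map T =
      volume.withDensity fun y => ENNReal.ofReal (b₁ y + b₂ y + b₃ y) := by
    have hsplit : gaussianReal 0 1 = (gaussianReal 0 1).restrict (Set.Iio (-a)) +
        (gaussianReal 0 1).restrict (Set.Ioo (-a) a) + (gaussianReal 0 1).restrict (Set.Ioi a) := by
      have := nullSingletonClass_gaussianReal (μ := 0) (one_ne_zero (α := ℝ≥0))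
      have hd₁ : Disjoint (Set.Iio (-a)) (Set.Ico (-a) a) :=
        Set.disjoint_left.2 fun x hx hx' => not_lt.2 hx'.1 hx
      have hd₂ : Disjoint (Set.Iio a) (Set.Ici a) :=
        Set.disjoint_left.2 fun x (hx : x < a) (hx' : a ≤ x) => hx'.not_gt hx
      rw [restrict_Ioo_eq_restrict_Ico, restrict_Ioi_eq_restrict_Ici,
        ← Measure.restrict_union hd₁ measurableSet_Ico, Set.Iio_union_Ico_eq_Iio (by linarith),
        ← Measure.restrict_union hd₂ measurableSet_Ici, Set.Iio_union_Ici, Measure.restrict_univ]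
    have hgd : gaussianReal 0 1 = volume.withDensity
        fun x => ENNReal.ofReal (gaussianPDFReal 0 1 x) := by
      rw [gaussianReal_of_var_ne_zero 0 one_ne_zero, gaussianPDF_def]
    rw [hsplit, Measure.map_add _ _ hTc.measurable, Measure.map_add _ _ hTc.measurable, hgd, hb₁,
      hb₂, hb₃, ← withDensity_add_left (by fun_prop), ← withDensity_add_left (by fun_prop)]
    congr 1
    ext y
    simp only [Pi.add_apply]
    rw [ENNReal.ofReal_add (add_nonneg (hb₁0 y) (hb₂0 y)) (hb₃0 y),
      ENNReal.ofReal_add (hb₁0 y) (hb₂0 y)]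
  -- behaviour of the branches
  have hkcrit : Tendsto k (𝓝[<] a) atTop := by
    have h1 : Tendsto (fun x => |T' x|) (𝓝[<] a) (𝓝[>] 0) := by
      refine tendsto_nhdsWithin_iff.2 ⟨?_, ?_⟩
      · have := (hT'c.abs.tendsto a).mono_left (nhdsWithin_le_nhds (s := Set.Iio a))
        rwa [hT'eq, sub_self, mul_zero, zero_mul, abs_zero] at this
      · filter_upwards [Ioo_mem_nhdsLT (show -a < a by linarith)] with x hx
        have h1 := hx.1
        have h2 := hx.2
        rw [Set.mem_Ioi, abs_pos, hT'eq]
        exact mul_ne_zero (mul_ne_zero (by positivity) (by linarith)) (by linarith)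
    exact Tendsto.pos_mul_atTop (gaussianPDFReal_pos 0 1 a one_ne_zero)
      ((hGc.tendsto a).mono_left nhdsWithin_le_nhds) h1.inv_tendsto_nhdsGT_zero
  have hkreg : Tendsto k (𝓝[<] (-(2 * a))) (𝓝 (k (-(2 * a)))) := by
    refine Tendsto.mono_left ?_ nhdsWithin_le_nhds
    refine (hGc.continuousAt.div hT'c.abs.continuousAt ?_).tendsto
    rw [abs_ne_zero, hT'eq]
    exact mul_ne_zero (mul_ne_zero (by positivity) (by linarith)) (by linarith)
  have hInside : ∀ᶠ x in 𝓝[<] a, x ∈ Set.Ioo (-a) a := Ioo_mem_nhdsLT (by linarith)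
  have hOutside : ∀ᶠ x in 𝓝[<] (-(2 * a)), x < -(2 * a) := self_mem_nhdsWithin
  have hlt : ∀ᶠ x in 𝓝[<] a, T x < T a := hInside.mono fun x hx => by
    have h1 := hx.1
    have h2 := hx.2
    have : 0 < h * (x - a) ^ 2 * (x + 2 * a) :=
      mul_pos (mul_pos hh (sq_pos_of_neg (by linarith))) (by linarith)
    linarith [hcrit x]
  have hgt : ∀ᶠ x in 𝓝[<] (-(2 * a)), T (-(2 * a)) < T x := hOutside.mono fun x hx => by
    have : h * (x - a) ^ 2 * (x + 2 * a) < 0 :=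
      mul_neg_of_pos_of_neg (mul_pos hh (sq_pos_of_neg (by linarith))) (by linarith)
    linarith [hcrit x]
  have hnT : Continuous fun x => -T x := hTc.neg
  refine ⟨fun y => b₁ y + b₂ y + b₃ y, by fun_prop,
    fun y => add_nonneg (add_nonneg (hb₁0 y) (hb₂0 y)) (hb₃0 y), hρ, ?_, ?_, ?_, ?_⟩
  · have : Tendsto b₂ (𝓝[<] (2 / 3 * a)) atTop := by
      rw [← hTa]
      refine Tendsto.mono_left ?_ (nhdsLT_le_map_nhdsLT hTc hlt)
      exact tendsto_map'_iff.2 (hkcrit.congr' (hInside.mono fun x hx => (hb₂T x hx).symm))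
    exact tendsto_atTop_mono (fun y => by linarith [hb₁0 y, hb₃0 y]) this
  · refine ⟨k (-(2 * a)), ?_⟩
    have : Tendsto b₁ (𝓝[>] (2 / 3 * a)) (𝓝 (k (-(2 * a)))) := by
      rw [← hT2a]
      refine Tendsto.mono_left ?_ (nhdsGT_le_map_nhdsLT hTc hgt)
      exact tendsto_map'_iff.2 (hkreg.congr' (hOutside.mono fun x hx =>
        (hb₁T x (show x < -a by linarith)).symm))
    -- Both `T` on `(-a, a)` and `T` on `(a, ∞)` stay at or below the critical value, so only the
    -- left branch contributes here.
    refine this.congr' ?_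
    filter_upwards [self_mem_nhdsWithin] with y (hy : 2 / 3 * a < y)
    rw [hb₂i, hb₃i, add_zero, add_zero]
    · rintro ⟨x, hx, rfl⟩
      have hx' : a < x := hx
      linarith [hTle x (by linarith)]
    · rintro ⟨x, hx, rfl⟩
      linarith [hTle x hx.1]
  -- Oddness of `T` and evenness of `k` reduce this side to the previous one, with `-T` in place of
  -- `T`.
  · have : Tendsto b₂ (𝓝[>] (-(2 / 3 * a))) atTop := by
      rw [← hTa]
      refine Tendsto.mono_left ?_ (nhdsGT_le_map_nhdsLT hnT (hlt.mono fun x hx => neg_lt_neg hx))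
      refine tendsto_map'_iff.2 (hkcrit.congr' (hInside.mono fun x hx => ?_))
      have := hb₂T (-x) ⟨by linarith [hx.2], by linarith [hx.1]⟩
      rw [hTneg] at this
      rw [Function.comp_apply, this, ← hkneg]
    exact tendsto_atTop_mono (fun y => by linarith [hb₁0 y, hb₃0 y]) this
  · refine ⟨k (-(2 * a)), ?_⟩
    have : Tendsto b₃ (𝓝[<] (-(2 / 3 * a))) (𝓝 (k (-(2 * a)))) := by
      rw [← hT2a]
      refine Tendsto.mono_left ?_ (nhdsLT_le_map_nhdsLT hnT (hgt.mono fun x hx => neg_lt_neg hx))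
      refine tendsto_map'_iff.2 (hkreg.congr' (hOutside.mono fun x hx => ?_))
      have := hb₃T (-x) (show a < -x by linarith)
      rw [hTneg] at this
      rw [Function.comp_apply, this, ← hkneg]
    refine this.congr' ?_
    filter_upwards [self_mem_nhdsWithin] with y (hy : y < -(2 / 3 * a))
    rw [hb₁i, hb₂i, add_zero, zero_add]
    · rintro ⟨x, hx, rfl⟩
      linarith [hTge x hx.2]
    · rintro ⟨x, hx, rfl⟩
      have hx' : x < -a := hx
      linarith [hTge x (by linarith)]

lemma map_cubic_mem_P2 (h : ℝ) : (gaussianReal 0 1).map (fun x => x - h * x ^ 3) ∈ P2 := by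
  refine ⟨Measure.isProbabilityMeasure_map (by fun_prop), ?_⟩
  rw [lintegral_map (by fun_prop) (by fun_prop)]
  have hi : Integrable (fun x : ℝ => (x - h * x ^ 3) ^ 2) (gaussianReal 0 1) := by
    have : (fun x : ℝ => (x - h * x ^ 3) ^ 2) =
        fun x => x ^ 2 - 2 * h * x ^ 4 + h ^ 2 * x ^ 6 := by
      ext x
      ring
    rw [this]
    exact ((integrable_pow_gaussianReal 2).sub ((integrable_pow_gaussianReal 4).const_mul _)).add
      ((integrable_pow_gaussianReal 6).const_mul _)
  simpa [HasFiniteIntegral, enorm_pow] using hi.2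

end Cubic

/-! ### Assembly of the four claims. -/

theorem mainTheorem2 :
    (∃ v : ℝ → ℝ, IsW2Gradient energyF (gaussianReal 0 1) v) ∧
    ∀ v : ℝ → ℝ, IsW2Gradient energyF (gaussianReal 0 1) v →
    ∀ h : ℝ, 0 < h →
    ∀ T : ℝ → ℝ, T = eulerMap h v →
    ∀ ρ₁ : Measure ℝ, ρ₁ = (gaussianReal 0 1).map T →
    ∀ c : ℝ, c = 2 / 3 * √(1 / (3 * h)) →
      (∀ x, T x = x - h * x ^ 3) ∧
      ¬ Function.Injective T ∧
      ρ₁ ∈ P2 ∧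
      (∃ p₁ : ℝ → ℝ, Measurable p₁ ∧ (∀ y, 0 ≤ p₁ y) ∧
        ρ₁ = volume.withDensity (fun y => ENNReal.ofReal (p₁ y)) ∧
        Tendsto p₁ (𝓝[<] c) atTop ∧ (∃ L : ℝ, Tendsto p₁ (𝓝[>] c) (𝓝 L)) ∧
        Tendsto p₁ (𝓝[>] (-c)) atTop ∧ (∃ L : ℝ, Tendsto p₁ (𝓝[<] (-c)) (𝓝 L)) ∧
        ∀ p : ℝ → ℝ, p =ᵐ[volume] p₁ →
          ¬ ContinuousAt p c ∧ ¬ ContinuousAt p (-c) ∧ ¬ MemW11loc p) ∧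
      ρ₁ ∉ slopeDomain energyF := by
  refine ⟨⟨_, isW2Gradient_cube⟩, ?_⟩
  intro v hv h hh T hT ρ₁ hρ₁ c hc
  have hTx : T = fun x => x - h * x ^ 3 := by
    ext x
    rw [hT, eulerMap, hv.eq_cube]
  have ha0 : 0 < √(1 / (3 * h)) := Real.sqrt_pos.2 (by positivity)
  have ha : 3 * h * √(1 / (3 * h)) ^ 2 = 1 := by
    rw [Real.sq_sqrt (by positivity)]
    field_simp
  obtain ⟨p, hpm, hp0, hp, hc1, hc2, hc3, hc4⟩ := exists_density_map_cubic hh ha0 ha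
  rw [← hTx, ← hρ₁] at hp
  rw [← hc] at hc1 hc2 hc3 hc4
  have hP2 : ρ₁ ∈ P2 := by
    rw [hρ₁, hTx]
    exact map_cubic_mem_P2 h
  have hpi : Integrable p := by
    refine ⟨hpm.aestronglyMeasurable, ?_⟩
    rw [hasFiniteIntegral_iff_ofReal (ae_of_all _ hp0)]
    have := hP2.1.measure_univ
    rw [hp, withDensity_apply _ MeasurableSet.univ, setLIntegral_univ] at this
    rw [this]
    exact ENNReal.one_lt_top
  have hblow : ∀ q : ℝ → ℝ, q =ᵐ[volume] p → ∀ M : ℝ, ∃ δ > 0, ∀ᵐ x, x ∈ Set.Ioo (c - δ) c →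
      M ≤ q x := by
    intro q hq M
    obtain ⟨l, hl, hs⟩ := mem_nhdsLT_iff_exists_Ioo_subset.1 (hc1.eventually_ge_atTop M)
    refine ⟨c - l, sub_pos.2 hl, ?_⟩
    filter_upwards [hq] with x hx hxI
    rw [hx]
    exact hs (by simpa using hxI)
  refine ⟨congrFun hTx, ?_, hP2, ⟨p, hpm, hp0, hp, hc1, hc2, hc3, hc4, fun q hq =>
    ⟨?_, ?_, not_memW11loc_of_blowup (hblow q hq)⟩⟩, ?_⟩
  · intro hinj
    -- `0` and `√(1/h)` are both zeros of the cubic.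
    have h0 : √(1 / h) = 0 := hinj <| by
      have : √(1 / h) ^ 2 = 1 / h := Real.sq_sqrt (by positivity)
      rw [hTx]
      simp only
      rw [pow_succ, this]
      field_simp
      simp
    exact (Real.sqrt_pos.2 (by positivity : 0 < 1 / h)).ne' h0
  · refine not_continuousAt_of_ae_eq_tendsto_atTop hq nhdsWithin_le_nhds (fun s hs => ?_) hc1
    obtain ⟨l, hl, hs⟩ := mem_nhdsLT_iff_exists_Ioo_subset.1 hs
    exact ((Measure.measure_Ioo_pos volume).2 hl |>.trans_le (measure_mono hs)).ne'
  · refine not_continuousAt_of_ae_eq_tendsto_atTop hq nhdsWithin_le_nhds (fun s hs => ?_) hc3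
    obtain ⟨l, hl, hs⟩ := mem_nhdsGT_iff_exists_Ioo_subset.1 hs
    exact ((Measure.measure_Ioo_pos volume).2 hl |>.trans_le (measure_mono hs)).ne'
  · rw [hp]
    exact notMem_slopeDomain_of_blowup hpm hp0 hpi.locallyIntegrable (hblow p (ae_eq_refl p))
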